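/- Let $(E,\mathcal E)$ be a measurable space and let $\mathcal B$ be the complex Banach space of bounded $\mathcal E$-measurable functions $f:E\to\mathbb C$ with the supremum norm. A bounded positive kernel is a map $Q:E\times\mathcal E\to[0,\infty)$ such that $Q(\cdot,A)$ is measurable for every $A\in\mathcal E$, $Q(x,\cdot)$ is a positive measure for every $x\in E$, and $\sup_{x}Q(x,E)<\infty$. A bounded kernel is a map $K:E\times\mathcal E\to\mathbb C$ such that $K(\cdot,A)$ is measurable for every $A$, $K(x,\cdot)$ is a complex measure for every $x$, and $\sup_{x,A}|K(x,A)|<\infty$. A kernel of either type acts as a bounded operator on $\mathcal B$ by $Kf(x)=\int_E f(y)\,K(x,dy)$; products and powers of kernels are compositions, and $\|K\|$ and $r(K)$ denote the operator norm and the spectral radius of $K$ on $\mathcal B$. The essential spectral radius $r_e(T)$ of a bounded operator $T$ on $\mathcal B$ is the infimum of $r(T)$ and of the real numbers $\rho\ge 0$ for which $\mathcal B=F_\rho\oplus H_\rho$ with $F_\rho,H_\rho$ invariant under $T$, $H_\rho$ closed, $r(T|_{H_\rho})<\rho$, $\dim F_\rho<\infty$, and all eigenvalues of $T|_{F_\rho}$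 of modulus $\ge\rho$. The operator $T$ is quasi-compact if $r_e(T)<r(T)$. Let $\mathcal P$ be the set of probability measures on $(E,\mathcal E)$. For $\nu\in\mathcal P$ and a bounded positive kernel $Q$, put $$\Delta_\nu(Q)=\limsup_{A\in\mathcal E,\ \nu(A)\to0}\ \sup_{x\in E}Q(x,A),$$ where sets with $\nu(A)=0$ are included in the upper limit. Let $\mathcal H_\nu$ be the set of measurable functions $\alpha:E\times E\to[0,\infty)$ such that $$\lim_{m\to\infty}\ \sup_{x\in E}\int_{\{y:\alpha(x,y)\ge m\}}\alpha(x,y)\,d\nu(y)=0,$$ and for $\alpha\in\mathcal H_\nu$ let $T_{\nu,\alpha}(x,A)=\int_A\alpha(x,y)\,d\nu(y)$. **Theorem.** Let $Q$ be a bounded positive kernel that is quasi-compact on $\mathcal B$, and let $\rho$ be a real number with $r_e(Q)<\rho<r(Q)$. Then: (i) There are bounded kernels $L$ and $N$ such that $Q=L+N$, $LN=NL=0$, $r(N)<\rho$, $L$ has finite-dimensional range, and every nonzero eigenvalue of $L$ has modulus $\ge\rho$. Moreover, there is an integer $\ell_\rho\ge1$ such that for every integer $\ell\ge\ell_\rho$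 there is $\nu\in\mathcal P$ for which both of the following hold: (ii) $\Delta_\nu(Q^\ell)\le\rho^\ell$; (iii) if moreover $\mathcal E$ is countably generated, there is $\alpha\in\mathcal H_\nu$ such that $S=Q^\ell-T_{\nu,\alpha}\ge0$ (that is, $Q^\ell(x,A)\ge T_{\nu,\alpha}(x,A)$ for all $x\in E$, $A\in\mathcal E$) and $\|S\|^{1/\ell}<\rho$. -/

import Mathlib

open MeasureTheory ProbabilityTheory Filter Topology
open scoped ENNReal NNReal

namespace QuasiCompactKernels

/-! ### Essential spectral radius of an operator on a complex Banach space -/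

section Operators

variable {B : Type*} [NormedAddCommGroup B] [NormedSpace ℂ B]

/-- `T` admits a decomposition at level `ρ`: the space is the algebraic direct sum of two
`T`-invariant subspaces `F` and `H`, where `H` is closed and `r(T|_H) < ρ`, while `F` is
finite-dimensional and the eigenvalues of `T|_F` have modulus at least `ρ`. -/
def HasDecompositionAt (T : B →L[ℂ] B) (ρ : ℝ≥0) : Prop :=
  ∃ F H : Submodule ℂ B, ∃ hF : ∀ f ∈ F, (T : B →ₗ[ℂ] B) f ∈ F, ∃ hH : ∀ f ∈ H, T f ∈ H,
    IsCompl F H ∧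
    IsClosed (H : Set B) ∧
    spectralRadius ℂ (T.restrict hH : H →L[ℂ] H) < (ρ : ℝ≥0∞) ∧
    FiniteDimensional ℂ F ∧
    ∀ z : ℂ, Module.End.HasEigenvalue ((T : B →ₗ[ℂ] B).restrict hF) z → (ρ : ℝ) ≤ ‖z‖

/-- The essential spectral radius: the infimum of `r(T)` and of all `ρ ≥ 0` at which `T` admits
a decomposition. -/
noncomputable def essSpectralRadius (T : B →L[ℂ] B) : ℝ≥0∞ :=
  sInf ({spectralRadius ℂ T} ∪ {r | ∃ ρ : ℝ≥0, HasDecompositionAt T ρ ∧ r = (ρ : ℝ≥0∞)})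

/-- `T` is quasi-compact when `r_e(T) < r(T)`. -/
def IsQuasiCompact (T : B →L[ℂ] B) : Prop :=
  essSpectralRadius T < spectralRadius ℂ T

end Operators

/-! ### The Banach space of bounded measurable functions -/

section Space

variable (E : Type*) [MeasurableSpace E]

/-- The bounded measurable complex functions on `E`, as a subspace of the Banach space of all
bounded functions with the supremum norm. -/
def bddMeasSubmodule : Submodule ℂ (lp (fun _ : E => ℂ) ∞) where
  carrier := {f | Measurable (fun x => f x)}
  add_mem' := by
    intro f g hf hg
    exact Measurable.add hf hg
  zero_mem' := measurable_const
  smul_mem' := by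
    intro c f hf
    exact Measurable.const_smul hf c

/-- The space of bounded measurable complex functions on `E` with the supremum norm. -/
abbrev BddMeas : Type _ := bddMeasSubmodule E

theorem isClosed_bddMeasSubmodule :
    IsClosed (bddMeasSubmodule E : Set (lp (fun _ : E => ℂ) ∞)) := by
  rw [← isSeqClosed_iff_isClosed]
  intro u f hu huf
  refine measurable_of_tendsto_metrizable (f := fun n x => u n x) (fun n => hu n) ?_
  rw [tendsto_pi_nhds]
  intro x
  rw [tendsto_iff_norm_sub_tendsto_zero] at huf ⊢
  refine squeeze_zero (fun _ => norm_nonneg _) (fun n => ?_) huf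
  exact lp.norm_apply_le_norm ENNReal.top_ne_zero (u n - f) x

instance : CompleteSpace (BddMeas E) :=
  (isClosed_bddMeasSubmodule E).completeSpace_coe

variable {E}

namespace BddMeas

instance : FunLike (BddMeas E) E ℂ where
  coe f := (f : lp (fun _ : E => ℂ) ∞)
  coe_injective _ _ h := Subtype.ext (lp.ext h)

theorem measurable (f : BddMeas E) : Measurable (fun x => f x) := f.2

theorem norm_apply_le (f : BddMeas E) (x : E) : ‖f x‖ ≤ ‖f‖ :=
  lp.norm_apply_le_norm ENNReal.top_ne_zero (f : lp (fun _ : E => ℂ) ∞) x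

/-- A bounded measurable function as an element of `BddMeas E`. -/
def mk (g : E → ℂ) (hg : Measurable g) (C : ℝ) (hC : ∀ x, ‖g x‖ ≤ C) : BddMeas E :=
  ⟨⟨g, memℓp_infty ⟨C, by rintro _ ⟨x, rfl⟩; exact hC x⟩⟩, hg⟩

@[simp] theorem mk_apply (g : E → ℂ) (hg : Measurable g) (C : ℝ) (hC : ∀ x, ‖g x‖ ≤ C) (x : E) :
    mk g hg C hC x = g x := rfl

theorem ext_apply {f g : BddMeas E} (h : ∀ x, f x = g x) : f = g :=
  Subtype.ext (lp.ext (funext h))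

theorem norm_mk_le (g : E → ℂ) (hg : Measurable g) (C : ℝ) (hC : ∀ x, ‖g x‖ ≤ C) (h0 : 0 ≤ C) :
    ‖mk g hg C hC‖ ≤ C :=
  lp.norm_le_of_forall_le h0 hC

end BddMeas

end Space

/-! ### Kernels and the operators that they define -/

section Kernels

variable {E : Type*} [MeasurableSpace E]

theorem norm_integral_kernel_le (Q : Kernel E E) [IsFiniteKernel Q] (f : BddMeas E) (x : E) :
    ‖∫ y, f y ∂(Q x)‖ ≤ Q.bound.toReal * ‖f‖ := by
  have h := norm_integral_le_of_norm_le_const (μ := Q x) (f := fun y => f y) (C := ‖f‖)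
    (Eventually.of_forall fun y => f.norm_apply_le y)
  refine h.trans ?_
  rw [mul_comm]
  gcongr
  exact ENNReal.toReal_mono Q.bound_ne_top (Q.measure_le_bound x _)

theorem integrable_kernel (Q : Kernel E E) [IsFiniteKernel Q] (f : BddMeas E) (x : E) :
    Integrable (fun y => f y) (Q x) :=
  Integrable.of_bound f.measurable.aestronglyMeasurable ‖f‖
    (Eventually.of_forall fun y => f.norm_apply_le y)

/-- The operator `f ↦ (x ↦ ∫ f(y) Q(x, dy))` defined by a bounded positive kernel on the bounded
measurable functions. Mathlib's finite kernels (`x ↦ Q x` measurable, `sup_x Q x E < ∞`) are the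
bounded positive kernels. -/
noncomputable def kernelOp (Q : Kernel E E) [IsFiniteKernel Q] : BddMeas E →L[ℂ] BddMeas E :=
  LinearMap.mkContinuous
    { toFun := fun f => BddMeas.mk (fun x => ∫ y, f y ∂(Q x))
        (f.measurable.stronglyMeasurable.integral_kernel).measurable
        (Q.bound.toReal * ‖f‖) (norm_integral_kernel_le Q f)
      map_add' := by
        intro f g
        refine BddMeas.ext_apply fun x => ?_
        exact integral_add (integrable_kernel Q f x) (integrable_kernel Q g x)
      map_smul' := by
        intro c f
        refine BddMeas.ext_apply fun x => ?_
        exact integral_const_mul c _ }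
    Q.bound.toReal
    (fun f => BddMeas.norm_mk_le _ _ _ (norm_integral_kernel_le Q f) (by positivity))

theorem kernelOp_apply (Q : Kernel E E) [IsFiniteKernel Q] (f : BddMeas E) (x : E) :
    kernelOp Q f x = ∫ y, f y ∂(Q x) := rfl

variable (E) in
/-- Bounded (complex) kernels: `x ↦ K(x, A)` is measurable for each measurable `A`, each
`K(x, ·)` is a complex measure, and `sup_{x, A} |K(x, A)| < ∞`. -/
structure BoundedKernel where
  toFun : E → ComplexMeasure E
  measurable_apply : ∀ A, MeasurableSet A → Measurable fun x => toFun x A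
  exists_bound : ∃ C : ℝ, ∀ x A, MeasurableSet A → ‖toFun x A‖ ≤ C

theorem signed_variation_le {s : SignedMeasure E} {C : ℝ}
    (h : ∀ A, MeasurableSet A → ‖s A‖ ≤ C) :
    s.variation Set.univ ≤ ENNReal.ofReal C + ENNReal.ofReal C := by
  rw [← SignedMeasure.totalVariation_eq_variation]
  obtain ⟨i, hi, hpos, hneg, h1, h2⟩ := s.toJordanDecomposition_spec
  rw [SignedMeasure.totalVariation, Measure.add_apply, h1, h2,
    SignedMeasure.toMeasureOfZeroLE_apply s hpos hi MeasurableSet.univ,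
    SignedMeasure.toMeasureOfLEZero_apply s hneg hi.compl MeasurableSet.univ,
    ← ENNReal.ofReal_coe_nnreal, ← ENNReal.ofReal_coe_nnreal]
  gcongr
  · exact (le_abs_self _).trans (h _ (hi.inter MeasurableSet.univ))
  · exact (neg_le_abs _).trans (h _ (hi.compl.inter MeasurableSet.univ))

theorem complex_variation_le {μ : ComplexMeasure E} {C : ℝ}
    (h : ∀ A, MeasurableSet A → ‖μ A‖ ≤ C) :
    μ.variation Set.univ ≤ ENNReal.ofReal (4 * C) := by
  have hC : 0 ≤ C := (norm_nonneg _).trans (h ∅ MeasurableSet.empty)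
  have hre : ∀ A, MeasurableSet A → ‖ComplexMeasure.re μ A‖ ≤ C := fun A hA =>
    (Complex.abs_re_le_norm _).trans (h A hA)
  have him : ∀ A, MeasurableSet A → ‖ComplexMeasure.im μ A‖ ≤ C := fun A hA =>
    (Complex.abs_im_le_norm _).trans (h A hA)
  have key : μ.variation ≤
      (ComplexMeasure.re μ).variation + (ComplexMeasure.im μ).variation := by
    refine VectorMeasure.variation_le_of_forall_enorm_le fun A _ => ?_
    rw [Measure.add_apply]
    have e : μ A = ((ComplexMeasure.re μ A : ℝ) : ℂ) + ((ComplexMeasure.im μ A : ℝ) : ℂ)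
        * Complex.I := (Complex.re_add_im (μ A)).symm
    rw [e]
    refine (enorm_add_le _ _).trans ?_
    gcongr
    · refine le_trans (le_of_eq ?_)
        (VectorMeasure.enorm_measure_le_variation (ComplexMeasure.re μ) A)
      rw [← ofReal_norm, ← ofReal_norm, Complex.norm_real]
    · refine le_trans (le_of_eq ?_)
        (VectorMeasure.enorm_measure_le_variation (ComplexMeasure.im μ) A)
      rw [← ofReal_norm, ← ofReal_norm, norm_mul, Complex.norm_I, mul_one, Complex.norm_real]
  refine (key Set.univ).trans ?_
  rw [Measure.add_apply]
  refine (add_le_add (signed_variation_le hre) (signed_variation_le him)).trans ?_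
  rw [← ENNReal.ofReal_add hC hC, ← ENNReal.ofReal_add (by linarith) (by linarith)]
  exact le_of_eq (congrArg _ (by ring))

/-- The integral of a complex function with respect to a complex measure. -/
noncomputable def complexIntegral (μ : ComplexMeasure E) (f : E → ℂ) : ℂ :=
  VectorMeasure.integral μ f (ContinuousLinearMap.mul ℝ ℂ)

namespace BoundedKernel

/-- A constant bounding all `|K(x, A)|`. -/
noncomputable def bound (K : BoundedKernel E) : ℝ := K.exists_bound.choose

theorem norm_apply_le (K : BoundedKernel E) (x : E) (A : Set E) (hA : MeasurableSet A) :
    ‖K.toFun x A‖ ≤ K.bound := K.exists_bound.choose_spec x A hA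

instance isFiniteMeasure_variation (K : BoundedKernel E) (x : E) :
    IsFiniteMeasure (K.toFun x).variation :=
  ⟨(complex_variation_le (K.norm_apply_le x)).trans_lt ENNReal.ofReal_lt_top⟩

theorem integrable (K : BoundedKernel E) (f : BddMeas E) (x : E) :
    Integrable (fun y => f y) (K.toFun x).variation :=
  Integrable.of_bound f.measurable.aestronglyMeasurable ‖f‖
    (Eventually.of_forall fun y => f.norm_apply_le y)

theorem norm_integral_le (K : BoundedKernel E) (f : BddMeas E) (x : E) :
    ‖complexIntegral (K.toFun x) (fun y => f y)‖ ≤ max (4 * K.bound) 0 * ‖f‖ := by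
  have h := VectorMeasure.norm_integral_le_integral_norm (μ := K.toFun x)
    (B := ContinuousLinearMap.mul ℝ ℂ) (f := fun y => f y)
  refine h.trans ?_
  have hB : ‖ContinuousLinearMap.mul ℝ ℂ‖ ≤ 1 := ContinuousLinearMap.opNorm_mul_le ℝ ℂ
  have h2 : ∫ y, ‖f y‖ ∂(K.toFun x).variation ≤ ‖f‖ * max (4 * K.bound) 0 := by
    have h3 : ∫ y, ‖f y‖ ∂(K.toFun x).variation ≤ ∫ _, ‖f‖ ∂(K.toFun x).variation :=
      integral_mono (K.integrable f x).norm (integrable_const _) fun y => f.norm_apply_le y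
    refine h3.trans ?_
    rw [integral_const, smul_eq_mul, mul_comm]
    gcongr
    have h4 := ENNReal.toReal_mono ENNReal.ofReal_ne_top
      (complex_variation_le (K.norm_apply_le x))
    rwa [ENNReal.toReal_ofReal'] at h4
  have h5 : 0 ≤ ∫ y, ‖f y‖ ∂(K.toFun x).variation := integral_nonneg fun _ => norm_nonneg _
  nlinarith

theorem measurable_integral_simpleFunc (K : BoundedKernel E) (g : SimpleFunc E ℂ) :
    Measurable fun x => complexIntegral (K.toFun x) g := by
  induction g using SimpleFunc.induction with
  | const c hs =>
    classical
    rename_i s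
    have : ∀ x, complexIntegral (K.toFun x) (SimpleFunc.piecewise s hs (SimpleFunc.const E c)
        (SimpleFunc.const E 0)) = c * K.toFun x s := by
      intro x
      rw [complexIntegral, SimpleFunc.coe_piecewise, SimpleFunc.coe_const, SimpleFunc.coe_const,
        Function.const_zero, Set.piecewise_eq_indicator, VectorMeasure.integral_indicator hs]
      have : IsFiniteMeasure ((K.toFun x).variation.restrict s) := inferInstance
      exact VectorMeasure.setIntegral_const c
    simp_rw [this]
    exact (K.measurable_apply s hs).const_mul c
  | add hd h1 h2 =>
    rename_i f g
    have : ∀ x, complexIntegral (K.toFun x) (f + g) =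
        complexIntegral (K.toFun x) f + complexIntegral (K.toFun x) g := fun x =>
      VectorMeasure.integral_add (SimpleFunc.integrable_of_isFiniteMeasure f)
        (SimpleFunc.integrable_of_isFiniteMeasure g)
    simp only [SimpleFunc.coe_add, this]
    exact h1.add h2

theorem measurable_integral (K : BoundedKernel E) (f : BddMeas E) :
    Measurable fun x => complexIntegral (K.toFun x) (fun y => f y) := by
  have hf := f.measurable.stronglyMeasurable
  refine measurable_of_tendsto_metrizable
    (fun n => K.measurable_integral_simpleFunc (hf.approxBounded ‖f‖ n)) ?_
  rw [tendsto_pi_nhds]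
  intro x
  refine VectorMeasure.tendsto_integral_of_dominated_convergence (fun _ => ‖f‖)
    (fun n => (SimpleFunc.stronglyMeasurable _).aestronglyMeasurable) (integrable_const _)
    (fun n => Eventually.of_forall fun y => hf.norm_approxBounded_le (norm_nonneg _) n y)
    (Eventually.of_forall fun y => hf.tendsto_approxBounded_of_norm_le (f.norm_apply_le y))

/-- The operator `f ↦ (x ↦ ∫ f(y) K(x, dy))` defined by a bounded kernel on the bounded
measurable functions. -/
noncomputable def op (K : BoundedKernel E) : BddMeas E →L[ℂ] BddMeas E :=
  LinearMap.mkContinuous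
    { toFun := fun f => BddMeas.mk (fun x => complexIntegral (K.toFun x) (fun y => f y))
        (K.measurable_integral f) (max (4 * K.bound) 0 * ‖f‖) (K.norm_integral_le f)
      map_add' := by
        intro f g
        refine BddMeas.ext_apply fun x => ?_
        exact VectorMeasure.integral_fun_add (K.integrable f x) (K.integrable g x)
      map_smul' := by
        intro c f
        refine BddMeas.ext_apply fun x => ?_
        exact setToFun_smul _ (fun c s z => smul_mul_assoc c z _) c _ }
    (max (4 * K.bound) 0)
    (fun f => BddMeas.norm_mk_le _ _ _ (K.norm_integral_le f) (by positivity))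

theorem op_apply (K : BoundedKernel E) (f : BddMeas E) (x : E) :
    K.op f x = complexIntegral (K.toFun x) (fun y => f y) := rfl

end BoundedKernel

/-- `Δ_ν(Q)`, the upper limit of `sup_x Q(x, A)` over measurable `A` with `ν(A) → 0`. -/
noncomputable def doeblinDelta (ν : Measure E) (Q : Kernel E E) : ℝ≥0∞ :=
  limsup (fun A : {A : Set E // MeasurableSet A} => ⨆ x, Q x A)
    (comap (fun A : {A : Set E // MeasurableSet A} => ν A) (𝓝 0))

/-- The class `ℋ_ν` of nonnegative measurable functions `α` on `E × E` whose sections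
`α(x, ·)` are uniformly `ν`-integrable. -/
def UnifIntegrableSections (ν : Measure E) : Set (E × E → ℝ≥0) :=
  {α | Measurable α ∧
    Tendsto (fun m : ℝ => ⨆ x, ∫⁻ y in {y | m ≤ (α (x, y) : ℝ)}, (α (x, y) : ℝ≥0∞) ∂ν)
      atTop (𝓝 0)}

/-- The absolutely continuous kernel `T_{ν,α}(x, A) = ∫_A α(x, y) dν(y)`. -/
noncomputable def acKernel (ν : Measure E) [SFinite ν] (α : E × E → ℝ≥0) : Kernel E E :=
  (Kernel.const E ν).withDensity fun x y => (α (x, y) : ℝ≥0∞)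

theorem acKernel_apply (ν : Measure E) [SFinite ν] {α : E × E → ℝ≥0} (hα : Measurable α)
    (x : E) {A : Set E} (hA : MeasurableSet A) :
    acKernel ν α x A = ∫⁻ y in A, (α (x, y) : ℝ≥0∞) ∂ν := by
  have h : Measurable (Function.uncurry fun x y => (α (x, y) : ℝ≥0∞)) := by
    exact hα.coe_nnreal_ennreal
  rw [acKernel, Kernel.withDensity_apply _ h, Kernel.const_apply, withDensity_apply _ hA]

end Kernels

end QuasiCompactKernels

/-! Write T for `kernelOp Q`. Since r_e(T) < ρ < r(T), the space splits at some level below ρ.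
Regrouping the generalised eigenspaces of the finite-dimensional summand at the threshold ρ gives a
finite-rank projection P that commutes with T, such that T has only eigenvalues of modulus ≥ ρ on
range P and ‖T^n (1 - P)‖ ≤ C s^n for some s < ρ (`HasDecompositionAt.exists_isSpectralProjection`).

The crux is `IsSpectralProjection.tendsto_zero`: if f_k is bounded and tends to 0 pointwise, then P
f_k tends to 0 in norm. By finite dimension, P f_k has norm limit points a. Dominated convergence
gives T^n f_k → 0 pointwise, so T^n a is a pointwise limit of -T^n (1 - P) f_k and hence is O(s^n).
A nonzero orbit in range P cannot stay that small (`eq_zero_of_growth`), so a = 0.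

Functionals with this continuity are integrals against complex measures, which makes L = T P and N =
T (1 - P) kernels and proves (i). The coordinates of P are such functionals; normalising the sum of
their variations yields a probability ν with ‖P 1_A‖ ≤ M ν(A). Hence Q^ℓ(x, A) ≤ ‖T^ℓ‖ M ν(A) + ‖T^ℓ
(1 - P)‖, whose last term is below ρ^ℓ for large ℓ; this is (ii). For (iii), `exists_acKernel_add`
truncates the Lebesgue density of Q^ℓ with respect to ν: the remainder lives on sets of small
ν-measure, where Q^ℓ is already known to be small. -/

namespace QuasiCompactKernels

/-! ### Spectral radius and geometric bounds on powers -/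

section SpectralRadius

variable {A : Type*} [NormedRing A] [NormedAlgebra ℂ A] [CompleteSpace A]

/-- Gelfand's formula, applied with a rate strictly between the spectral radius and `r`. -/
theorem exists_norm_pow_le_of_spectralRadius_lt (a : A) {r : ℝ≥0}
    (h : spectralRadius ℂ a < r) :
    ∃ s : ℝ, 0 < s ∧ s < r ∧ ∃ C : ℝ, 0 < C ∧ ∀ n : ℕ, ‖a ^ n‖ ≤ C * s ^ n := by
  obtain ⟨s, hs, hsr⟩ := ENNReal.lt_iff_exists_nnreal_btwn.1 h
  have hs0 : (0 : ℝ≥0) < s := by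
    have := (zero_le : (0:ℝ≥0∞) ≤ _).trans_lt hs
    exact_mod_cast this
  have hev := (spectrum.pow_nnnorm_pow_one_div_tendsto_nhds_spectralRadius a).eventually_lt_const hs
  have hO : (fun n : ℕ => a ^ n) =O[atTop] fun n : ℕ => (s : ℝ) ^ n := by
    refine Asymptotics.IsBigO.of_bound 1 ?_
    filter_upwards [hev, eventually_ge_atTop 1] with n hn hn1
    have hn0 : (n : ℝ) ≠ 0 := by positivity
    have h1 := ENNReal.rpow_le_rpow hn.le (Nat.cast_nonneg (α := ℝ) n)
    rw [← ENNReal.rpow_mul, one_div_mul_cancel hn0, ENNReal.rpow_one, ENNReal.rpow_natCast] at h1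
    rw [one_mul, norm_pow (s : ℝ), Real.norm_of_nonneg s.coe_nonneg]
    exact_mod_cast h1
  -- Enlarging the constant absorbs the finitely many initial exponents, since `s ^ n` never
  -- vanishes.
  obtain ⟨C, hC, hb⟩ := Asymptotics.bound_of_isBigO_nat_atTop hO
  refine ⟨s, hs0, by exact_mod_cast hsr, C, hC, fun n => ?_⟩
  have := hb (x := n) (by positivity)
  rwa [norm_pow (s : ℝ), Real.norm_of_nonneg s.coe_nonneg] at this

/-- If z is in the spectrum, z^n is in that of a^n, so |z|^n ≤ ‖a^n‖ ‖1‖, which excludes |z| > s.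
Excluding n = 0 lets this apply to T (1 - P), whose zeroth power is 1 and not 1 - P. -/
theorem spectralRadius_le_of_norm_pow_le (a : A) {s C : ℝ} (hs : 0 < s)
    (h : ∀ n : ℕ, n ≠ 0 → ‖a ^ n‖ ≤ C * s ^ n) : spectralRadius ℂ a ≤ ENNReal.ofReal s := by
  refine iSup₂_le fun z hz => ?_
  rw [← enorm_eq_nnnorm, ← ofReal_norm]
  refine ENNReal.ofReal_le_ofReal ?_
  by_contra! hlt
  have h1 : 1 < ‖z‖ / s := (one_lt_div hs).2 hlt
  obtain ⟨n, hn⟩ := ((tendsto_pow_atTop_atTop_of_one_lt h1).eventually_gt_atTop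
    (C * ‖(1 : A)‖)).and (eventually_ge_atTop 1) |>.exists
  have h2 := spectrum.norm_le_norm_mul_of_mem (spectrum.pow_mem_pow a n hz)
  have h3 := h n (by omega)
  rw [div_pow, lt_div_iff₀ (by positivity)] at hn
  rw [norm_pow] at h2
  have h4 := mul_le_mul_of_nonneg_right h3 (norm_nonneg (1 : A))
  linarith [hn.1]

theorem spectralRadius_lt_of_forall_norm_lt (a : A) {r : ℝ≥0} (hr : 0 < r)
    (h : ∀ z ∈ spectrum ℂ a, ‖z‖ < r) : spectralRadius ℂ a < r := by
  by_cases hne : (spectrum ℂ a).Nonempty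
  · exact spectrum.spectralRadius_lt_of_forall_lt_of_nonempty hne fun z hz => h z hz
  · rw [Set.not_nonempty_iff_eq_empty] at hne
    simpa [spectralRadius, hne] using hr

end SpectralRadius

/-! ### Finite-rank spectral projections -/

section Projections

variable {B : Type*} [NormedAddCommGroup B] [NormedSpace ℂ B]

/-- `P` is a finite-rank projection commuting with `T` which separates the part of the spectrum of
`T` in `{|z| ≥ ρ}` from the rest. -/
structure IsSpectralProjection (T P : B →L[ℂ] B) (ρ : ℝ) : Prop where
  idem : P * P = P
  comm : Commute T P
  finiteDimensional : FiniteDimensional ℂ (LinearMap.range (P : B →ₗ[ℂ] B))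
  le_norm : ∀ (z : ℂ) (v : B), P v = v → v ≠ 0 → T v = z • v → ρ ≤ ‖z‖
  growth : ∃ s : ℝ, 0 < s ∧ s < ρ ∧ ∃ C : ℝ, 0 < C ∧ ∀ n : ℕ, ‖T ^ n * (1 - P)‖ ≤ C * s ^ n

theorem mem_spectrum_iff_of_finiteDimensional [FiniteDimensional ℂ B] (f : B →L[ℂ] B) (z : ℂ) :
    z ∈ spectrum ℂ f ↔ Module.End.HasEigenvalue (f : B →ₗ[ℂ] B) z := by
  rw [Module.End.hasEigenvalue_iff_mem_spectrum,
    ← AlgEquiv.spectrum_eq (Module.End.toContinuousLinearMap (𝕜 := ℂ) B) (f : B →ₗ[ℂ] B)]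
  rfl

/-- The projection has as range the sum of the generalised eigenspaces with |z| ≥ ρ and as kernel
the sum of the others. The growth bound follows because an eigenvalue of f (1 - p) of modulus ≥ ρ
would be an eigenvalue of f with eigenvector in that kernel. -/
theorem exists_isSpectralProjection_of_finiteDimensional [FiniteDimensional ℂ B] (f : B →L[ℂ] B)
    {ρ : ℝ≥0} (hρ : 0 < ρ) : ∃ p : B →L[ℂ] B, IsSpectralProjection f p ρ := by
  have : CompleteSpace B := FiniteDimensional.complete ℂ B
  set φ : Module.End ℂ B := (f : B →ₗ[ℂ] B) with hφ
  set F : Submodule ℂ B := ⨆ z ∈ {z : ℂ | (ρ : ℝ) ≤ ‖z‖}, φ.maxGenEigenspace z with hF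
  set G : Submodule ℂ B := ⨆ z ∈ {z : ℂ | (ρ : ℝ) ≤ ‖z‖}ᶜ, φ.maxGenEigenspace z with hG
  have hFG : IsCompl F G := by
    refine ⟨φ.independent_maxGenEigenspace.disjoint_biSup_biSup disjoint_compl_right, ?_⟩
    rw [codisjoint_iff, eq_top_iff, ← φ.iSup_maxGenEigenspace_eq_top]
    refine iSup_le fun z => ?_
    by_cases hz : z ∈ {z : ℂ | (ρ : ℝ) ≤ ‖z‖}
    · exact le_sup_of_le_left (le_biSup φ.maxGenEigenspace hz)
    · exact le_sup_of_le_right (le_biSup φ.maxGenEigenspace (Set.mem_compl hz))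
  have hinv : ∀ S : Set ℂ, (⨆ z ∈ S, φ.maxGenEigenspace z) ∈ Module.End.invtSubmodule φ := by
    intro S
    rw [Module.End.mem_invtSubmodule]
    refine iSup₂_le fun z hz x hx => ?_
    exact le_biSup φ.maxGenEigenspace hz
      (Module.End.mapsTo_maxGenEigenspace_of_comm (Commute.refl φ) z hx)
  set q : B →ₗ[ℂ] B := F.projection G hFG with hq
  have hqid : IsIdempotentElem q := Submodule.isIdempotentElem_projection hFG
  have hcomm : Commute q φ := by
    rw [LinearMap.IsIdempotentElem.commute_iff hqid, hq, Submodule.range_projection,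
      Submodule.ker_projection]
    exact ⟨hinv _, hinv _⟩
  set p : B →L[ℂ] B := LinearMap.toContinuousLinearMap q with hp
  have hpp : p * p = p := ContinuousLinearMap.coe_injective hqid
  have hpf : Commute f p := (ContinuousLinearMap.coe_injective hcomm : p * f = f * p).symm
  have heig : ∀ z v, f v = z • v → v ∈ φ.maxGenEigenspace z := fun z v h =>
    Module.End.mem_maxGenEigenspace φ z v |>.2 ⟨1, by
      simp [hφ, h]⟩
  have hid1 : (1 - p) * (1 - p) = 1 - p := by
    have : IsIdempotentElem p := hpp
    exact this.one_sub
  have hc1 : Commute f (1 - p) := (Commute.one_right f).sub_right hpf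
  refine ⟨p, hpp, hpf, inferInstance, fun z v hv hv0 hz => ?_, ?_⟩
  · by_contra hlt
    refine hv0 (Submodule.disjoint_def.1 hFG.disjoint v ?_ ?_)
    · rw [← hv]; exact Submodule.projection_apply_mem hFG v
    · exact le_biSup φ.maxGenEigenspace (i := z) hlt (heig z v hz)
  · set g := f * (1 - p) with hg
    have hrad : spectralRadius ℂ g < ρ := by
      refine spectralRadius_lt_of_forall_norm_lt g hρ fun z hz => ?_
      rw [mem_spectrum_iff_of_finiteDimensional] at hz
      by_contra! hle
      obtain ⟨v, hv⟩ := hz.exists_hasEigenvector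
      have hgv : g v = z • v := hv.apply_eq_smul
      have hz0 : z ≠ 0 := by
        rintro rfl
        rw [norm_zero] at hle
        exact absurd hle (not_le.2 (by exact_mod_cast hρ))
      have h1 : (1 - p) (g v) = g v := by
        rw [hg, hc1.eq]
        change ((1 - p) * ((1 - p) * f)) v = _
        rw [← mul_assoc, hid1]
      have h2 : (1 - p) v = v := by
        rw [hgv, map_smul] at h1
        exact smul_right_injective B hz0 h1
      have h3 : p v = 0 := by simpa using h2
      have h4 : f v = z • v := by
        rw [← hgv, hg]
        exact (congrArg f h2).symm
      refine hv.2 (Submodule.disjoint_def.1 hFG.disjoint v ?_ ?_)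
      · exact le_biSup φ.maxGenEigenspace (i := z) hle (heig z v h4)
      · exact (Submodule.projection_apply_eq_zero_iff hFG).1 h3
    obtain ⟨s, hs0, hsρ, C, hC, hb⟩ := exists_norm_pow_le_of_spectralRadius_lt g hrad
    refine ⟨s, hs0, hsρ, C * (‖1 - p‖ + 1), by positivity, fun n => ?_⟩
    -- Keeping the factor 1 - p on the right makes the identity hold for n = 0 too.
    have h5 : f ^ n * (1 - p) = g ^ n * (1 - p) := by
      rw [hg, hc1.mul_pow, mul_assoc, ← pow_succ, IsIdempotentElem.pow_succ_eq n hid1]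
    rw [h5]
    refine (norm_mul_le _ _).trans ?_
    have := hb n
    calc ‖g ^ n‖ * ‖1 - p‖ ≤ (C * s ^ n) * (‖1 - p‖ + 1) := by
          gcongr; linarith
      _ = _ := by ring

/-- F may carry eigenvalues with modulus between ρ' and ρ, so F is split once more at ρ; the slow
part of F joins H in the kernel of P. -/
theorem HasDecompositionAt.exists_isSpectralProjection [CompleteSpace B] {T : B →L[ℂ] B}
    {ρ ρ' : ℝ≥0} (h : HasDecompositionAt T ρ') (hρ : ρ' ≤ ρ) :
    ∃ P : B →L[ℂ] B, IsSpectralProjection T P ρ := by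
  obtain ⟨F, H, hF, hH, hFH, hHc, hrad, hfin, -⟩ := h
  have hρ0 : 0 < ρ := by
    refine lt_of_lt_of_le ?_ hρ
    exact_mod_cast (zero_le : (0:ℝ≥0∞) ≤ _).trans_lt hrad
  have hFc : IsClosed (F : Set B) := F.closed_of_finiteDimensional
  have : CompleteSpace H := hHc.completeSpace_coe
  -- Two closed complements in a Banach space have continuous projections.
  have htop : Submodule.IsTopCompl F H :=
    Submodule.IsCompl.isTopCompl_of_isClosed hFH hFc hHc
  set u : B →L[ℂ] F := F.projectionOntoL H htop with hu
  set w : B →L[ℂ] H := H.projectionOntoL F htop.symm with hw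
  have huF : ∀ x : F, u x = x := fun x => by simp [hu]
  have hsum : ∀ x, (u x : B) + (w x : B) = x := fun x =>
    Submodule.projection_add_projection_eq_self hFH x
  have huH : ∀ x : H, u x = 0 := fun x => by simp [hu]
  set f : F →L[ℂ] F := T.restrict hF with hf
  set t : H →L[ℂ] H := T.restrict hH with ht
  have hgt := exists_norm_pow_le_of_spectralRadius_lt t (r := ρ') hrad
  obtain ⟨p, hp⟩ := exists_isSpectralProjection_of_finiteDimensional f hρ0
  have hiter : ∀ (n : ℕ) (x : F), ((f ^ n) x : B) = (T ^ n) x := by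
    intro n
    induction n with
    | zero => intro x; rfl
    | succ n ih => intro x; rw [pow_succ, pow_succ]; exact ih (f x)
  have htiter : ∀ (n : ℕ) (x : H), ((t ^ n) x : B) = (T ^ n) x := by
    intro n
    induction n with
    | zero => intro x; rfl
    | succ n ih => intro x; rw [pow_succ, pow_succ]; exact ih (t x)
  have huT : ∀ x, u (T x) = f (u x) := by
    intro x
    have h1 : T x = (f (u x) : B) + (t (w x) : B) := by
      conv_lhs => rw [← hsum x, map_add]
      rfl
    rw [h1, map_add, huF, huH, add_zero]
  set P : B →L[ℂ] B := F.subtypeL ∘L p ∘L u with hP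
  have hPx : ∀ x, P x = (p (u x) : B) := fun _ => rfl
  refine ⟨P, ?_, ?_, ?_, fun z v hv hv0 hz => ?_, ?_⟩
  · ext x
    show P (P x) = P x
    rw [hPx (P x), hPx x, huF]
    exact congrArg Subtype.val (DFunLike.congr_fun hp.idem (u x))
  · ext x
    show T (P x) = P (T x)
    rw [hPx, hPx, huT]
    exact congrArg Subtype.val (DFunLike.congr_fun hp.comm.eq (u x))
  · refine Submodule.finiteDimensional_of_le (S₂ := F) ?_
    rintro _ ⟨x, rfl⟩
    exact (p (u x)).2
  · have hvF : v ∈ F := by rw [← hv]; exact (p (u v)).2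
    have huv : u v = ⟨v, hvF⟩ := huF ⟨v, hvF⟩
    refine hp.le_norm z ⟨v, hvF⟩ ?_ ?_ ?_
    · apply Subtype.ext
      change (p ⟨v, hvF⟩ : B) = v
      rw [← huv]; exact hv
    · simpa [Subtype.ext_iff] using hv0
    · exact Subtype.ext hz
  · obtain ⟨s₁, hs₁, hs₁ρ, C₁, hC₁, hb₁⟩ := hp.growth
    obtain ⟨s₂, hs₂, hs₂ρ, C₂, hC₂, hb₂⟩ := hgt
    refine ⟨max s₁ s₂, lt_max_of_lt_left hs₁,
      max_lt hs₁ρ (hs₂ρ.trans_le (by exact_mod_cast hρ)),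
      C₁ * (‖u‖ + 1) + C₂ * (‖w‖ + 1), by positivity, fun n => ?_⟩
    refine ContinuousLinearMap.opNorm_le_bound _ (by positivity) fun x => ?_
    have h1 : (T ^ n * (1 - P)) x = ((f ^ n * (1 - p)) (u x) : B) + ((t ^ n) (w x) : B) := by
      show (T ^ n) (x - P x) = (((f ^ n) (u x - p (u x)) : F) : B) + _
      rw [hiter, htiter, ← map_add, hPx]
      congr 1
      conv_lhs => rw [← hsum x]
      push_cast
      rw [hsum x]
      nth_rw 1 [← hsum x]
      abel
    rw [h1]
    have e₁ : ‖(((f ^ n * (1 - p)) (u x) : F) : B)‖ ≤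
        (C₁ * max s₁ s₂ ^ n) * ((‖u‖ + 1) * ‖x‖) := by
      refine ((f ^ n * (1 - p)).le_opNorm (u x)).trans ?_
      gcongr
      · exact (hb₁ n).trans (by gcongr; exact le_max_left _ _)
      · refine (u.le_opNorm x).trans ?_
        gcongr; linarith
    have e₂ : ‖(((t ^ n) (w x) : H) : B)‖ ≤ (C₂ * max s₁ s₂ ^ n) * ((‖w‖ + 1) * ‖x‖) := by
      refine ((t ^ n).le_opNorm (w x)).trans ?_
      gcongr
      · exact (hb₂ n).trans (by gcongr; exact le_max_right _ _)
      · refine (w.le_opNorm x).trans ?_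
        gcongr; linarith
    calc _ ≤ _ := (norm_add_le _ _).trans (add_le_add e₁ e₂)
      _ = _ := by ring

theorem exists_isSpectralProjection_of_essSpectralRadius_lt [CompleteSpace B] {T : B →L[ℂ] B}
    {ρ : ℝ} (h₁ : essSpectralRadius T < ENNReal.ofReal ρ)
    (h₂ : ENNReal.ofReal ρ < spectralRadius ℂ T) :
    ∃ P : B →L[ℂ] B, IsSpectralProjection T P ρ := by
  have hρ : 0 < ρ := ENNReal.ofReal_pos.1 ((zero_le : (0:ℝ≥0∞) ≤ _).trans_lt h₁)
  -- Some member of the set lies below ρ; it is not r(T), so it is the level of a decomposition.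
  obtain ⟨r, hr | ⟨ρ', hdec, rfl⟩, hlt⟩ := sInf_lt_iff.1 h₁
  · rw [Set.mem_singleton_iff.1 hr] at hlt
    exact absurd hlt h₂.not_gt
  · have hle : ρ' ≤ ρ.toNNReal := ENNReal.coe_le_coe.1 hlt.le
    have := hdec.exists_isSpectralProjection hle
    rwa [Real.coe_toNNReal _ hρ.le] at this

/-! ### Growth of orbits, the two summands, and norm convergence under the projection -/

namespace IsSpectralProjection

variable {T P : B →L[ℂ] B} {ρ : ℝ}

/-- A vector in the range of the projection whose orbit grows slower than `ρ ^ n` vanishes. -/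
theorem eq_zero_of_growth (h : IsSpectralProjection T P ρ) {s : ℝ} (hs : 0 < s) (hsρ : s < ρ)
    {v : B} (hv : P v = v) {C : ℝ} (hb : ∀ n : ℕ, ‖(T ^ n) v‖ ≤ C * s ^ n) : v = 0 := by
  -- The slowly growing vectors of range P form a finite-dimensional T-invariant subspace. If
  -- nonzero, it contains an eigenvector x, and then ‖T^n x‖ ≥ ρ^n ‖x‖ contradicts the O(s^n) bound.
  let W : Submodule ℂ B :=
    { carrier := {x | P x = x ∧ ∃ C : ℝ, ∀ n : ℕ, ‖(T ^ n) x‖ ≤ C * s ^ n}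
      add_mem' := by
        rintro x y ⟨hx, C, hC⟩ ⟨hy, D, hD⟩
        refine ⟨by rw [map_add, hx, hy], C + D, fun n => ?_⟩
        rw [map_add, add_mul]
        exact (norm_add_le _ _).trans (add_le_add (hC n) (hD n))
      zero_mem' := ⟨map_zero _, 0, fun n => by simp⟩
      smul_mem' := by
        rintro c x ⟨hx, C, hC⟩
        refine ⟨by rw [map_smul, hx], ‖c‖ * C, fun n => ?_⟩
        rw [map_smul, norm_smul, mul_assoc]
        exact mul_le_mul_of_nonneg_left (hC n) (norm_nonneg c) }
  have hWT : ∀ x ∈ W, (T : B →ₗ[ℂ] B) x ∈ W := by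
    rintro x ⟨hx, C, hC⟩
    refine ⟨?_, C * s, fun n => ?_⟩
    · have := DFunLike.congr_fun h.comm.eq x
      change T (P x) = P (T x) at this
      rw [hx] at this
      exact this.symm
    · have := hC (n + 1)
      rw [pow_succ] at this
      refine this.trans (le_of_eq (by ring))
  have := h.finiteDimensional
  have hWfin : FiniteDimensional ℂ W := by
    refine Submodule.finiteDimensional_of_le
      (S₂ := LinearMap.range (P : B →ₗ[ℂ] B)) fun x hx => ⟨x, hx.1⟩
  by_contra hv0
  have hvW : v ∈ W := ⟨hv, C, hb⟩
  have : Nontrivial W := ⟨⟨v, hvW⟩, 0, fun h0 => hv0 (congrArg Subtype.val h0)⟩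
  obtain ⟨z, hz⟩ := Module.End.exists_eigenvalue ((T : B →ₗ[ℂ] B).restrict hWT)
  obtain ⟨x, hx⟩ := hz.exists_hasEigenvector
  have hTx : T (x : B) = z • (x : B) := congrArg Subtype.val hx.apply_eq_smul
  have hx0 : (x : B) ≠ 0 := fun h0 => hx.2 (Subtype.ext h0)
  have hzρ := h.le_norm z x x.2.1 hx0 hTx
  have hpow : ∀ n : ℕ, (T ^ n) (x : B) = z ^ n • (x : B) := by
    intro n
    induction n with
    | zero => simp
    | succ n ih =>
      rw [pow_succ, pow_succ']
      change (T ^ n) (T x) = _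
      rw [hTx, map_smul, ih, smul_smul]
  obtain ⟨D, hD⟩ := x.2.2
  have h1 : 1 < ρ / s := (one_lt_div hs).2 hsρ
  have hxn : 0 < ‖(x : B)‖ := norm_pos_iff.2 hx0
  obtain ⟨n, hn⟩ := ((tendsto_pow_atTop_atTop_of_one_lt h1).eventually_gt_atTop
    (D / ‖(x : B)‖)).exists
  rw [div_pow, div_lt_div_iff₀ hxn (by positivity)] at hn
  have h2 := hD n
  rw [hpow, norm_smul, norm_pow] at h2
  have h3 : ρ ^ n * ‖(x : B)‖ ≤ ‖z‖ ^ n * ‖(x : B)‖ := by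
    have : 0 < ρ := hs.trans hsρ
    gcongr
  linarith

theorem isIdempotentElem_one_sub (h : IsSpectralProjection T P ρ) :
    IsIdempotentElem (1 - P) :=
  IsIdempotentElem.one_sub h.idem

theorem commute_one_sub (h : IsSpectralProjection T P ρ) : Commute T (1 - P) :=
  (Commute.one_right T).sub_right h.comm

theorem mul_one_sub_pow (h : IsSpectralProjection T P ρ) {n : ℕ} (hn : n ≠ 0) :
    (T * (1 - P)) ^ n = T ^ n * (1 - P) := by
  rw [h.commute_one_sub.mul_pow, h.isIdempotentElem_one_sub.pow_eq hn]

theorem spectralRadius_mul_one_sub_lt [CompleteSpace B] (h : IsSpectralProjection T P ρ) :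
    spectralRadius ℂ (T * (1 - P)) < ENNReal.ofReal ρ := by
  obtain ⟨s, hs, hsρ, C, hC, hb⟩ := h.growth
  refine (spectralRadius_le_of_norm_pow_le (C := C) _ hs fun n hn => ?_).trans_lt
    ((ENNReal.ofReal_lt_ofReal_iff (hs.trans hsρ)).2 hsρ)
  rw [h.mul_one_sub_pow hn]
  exact hb n

/-- For z ≠ 0 an eigenvector of T P lies in range P, so it is an eigenvector of T there. -/
theorem le_norm_of_hasEigenvalue (h : IsSpectralProjection T P ρ) {z : ℂ} (hz : z ≠ 0)
    (he : Module.End.HasEigenvalue ((T * P : B →L[ℂ] B) : B →ₗ[ℂ] B) z) : ρ ≤ ‖z‖ := by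
  obtain ⟨v, hv⟩ := he.exists_hasEigenvector
  have hTP : T (P v) = z • v := hv.apply_eq_smul
  have h1 : P v = v := by
    have h2 : P (T (P v)) = T (P v) := by
      have h3 := DFunLike.congr_fun h.comm.eq (P v)
      change T (P (P v)) = P (T (P v)) at h3
      rw [← h3]
      exact congrArg T (DFunLike.congr_fun h.idem v)
    rw [hTP, map_smul] at h2
    exact smul_right_injective B hz h2
  rw [h1] at hTP
  exact h.le_norm z v h1 hv.2 hTP

theorem mul_eq_add (T P : B →L[ℂ] B) : T = T * P + T * (1 - P) := by
  rw [← mul_add, add_sub_cancel, mul_one]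

theorem mul_mul_mul_one_sub (h : IsSpectralProjection T P ρ) :
    T * P * (T * (1 - P)) = 0 := by
  have hPP : P * (1 - P) = 0 := by rw [mul_sub, mul_one, h.idem, sub_self]
  rw [h.commute_one_sub.eq, mul_assoc, ← mul_assoc P, hPP, zero_mul, mul_zero]

theorem mul_one_sub_mul_mul (h : IsSpectralProjection T P ρ) :
    T * (1 - P) * (T * P) = 0 := by
  have hPP' : (1 - P) * P = 0 := by rw [sub_mul, one_mul, h.idem, sub_self]
  rw [h.comm.eq, mul_assoc, ← mul_assoc (1 - P), hPP', zero_mul, mul_zero]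

theorem finiteDimensional_range_mul (h : IsSpectralProjection T P ρ) :
    FiniteDimensional ℂ (LinearMap.range ((T * P : B →L[ℂ] B) : B →ₗ[ℂ] B)) := by
  have := h.finiteDimensional
  refine Submodule.finiteDimensional_of_le (S₂ := LinearMap.range (P : B →ₗ[ℂ] B)) ?_
  rw [h.comm.eq]
  rintro _ ⟨x, rfl⟩
  exact ⟨T x, rfl⟩

theorem pow_apply_eq (n : ℕ) (v : B) :
    (T ^ n) v = (T ^ n) (P v) + (T ^ n * (1 - P)) v := by
  change _ = _ + (T ^ n) (v - P v)
  rw [← map_add, add_sub_cancel]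

/-- A bounded sequence all of whose images under powers of `T` tend to zero for a norming family
of functionals is sent by the projection to a sequence converging to zero in norm. -/
theorem tendsto_zero {X : Type*} (h : IsSpectralProjection T P ρ) (ev : X → B →L[ℂ] ℂ)
    (hle : ∀ x v, ‖ev x v‖ ≤ ‖v‖)
    (hnorm : ∀ (v : B) (C : ℝ), 0 ≤ C → (∀ x, ‖ev x v‖ ≤ C) → ‖v‖ ≤ C)
    {f : ℕ → B} {C : ℝ} (hC : ∀ k, ‖f k‖ ≤ C)
    (hf : ∀ n x, Tendsto (fun k => ev x ((T ^ n) (f k))) atTop (𝓝 0)) :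
    Tendsto (fun k => P (f k)) atTop (𝓝 0) := by
  -- Each subsequence has a further one along which P f_k converges, by compactness of balls in
  -- range P; it remains to see that the limit is 0.
  refine tendsto_of_subseq_tendsto fun ns hns => ?_
  have hfin := h.finiteDimensional
  have hproper : ProperSpace (LinearMap.range (P : B →ₗ[ℂ] B)) := FiniteDimensional.proper ℂ _
  obtain ⟨a, -, φ, hφ, hlim⟩ := tendsto_subseq_of_bounded
    (x := fun k => (⟨P (f (ns k)), ⟨f (ns k), rfl⟩⟩ : LinearMap.range (P : B →ₗ[ℂ] B)))
    (s := Metric.closedBall 0 (‖P‖ * C)) Metric.isBounded_closedBall fun k => by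
      rw [mem_closedBall_zero_iff]
      exact (P.le_opNorm _).trans (mul_le_mul_of_nonneg_left (hC _) (norm_nonneg P))
  have hlim' : Tendsto (fun k => P (f (ns (φ k)))) atTop (𝓝 (a : B)) :=
    (continuous_subtype_val.tendsto a).comp hlim
  have hC0 : 0 ≤ C := (norm_nonneg _).trans (hC 0)
  obtain ⟨s, hs, hsρ, D, hD, hb⟩ := h.growth
  have hPa : P (a : B) = a := by
    obtain ⟨y, hy⟩ := a.2
    rw [← hy]
    exact DFunLike.congr_fun h.idem y
  have ha : (a : B) = 0 := by
    refine h.eq_zero_of_growth hs hsρ hPa (C := D * C) fun n => ?_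
    refine hnorm _ _ (by positivity) fun x => ?_
    have h1 : Tendsto (fun k => ev x ((T ^ n) (P (f (ns (φ k)))))) atTop
        (𝓝 (ev x ((T ^ n) (a : B)))) :=
      ((ev x ∘L (T ^ n)).continuous.tendsto _).comp hlim'
    have h2 : Tendsto (fun k => ev x ((T ^ n) (f (ns (φ k))))) atTop (𝓝 0) :=
      (hf n x).comp (hns.comp hφ.tendsto_atTop)
    have h3 := (h2.sub h1).norm
    rw [zero_sub, norm_neg] at h3
    refine le_of_tendsto h3 (Eventually.of_forall fun k => ?_)
    -- T^n f_k - T^n P f_k = T^n (1 - P) f_k, which the growth bound controls uniformly in k.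
    rw [← map_sub, pow_apply_eq (P := P) n (f (ns (φ k))), add_sub_cancel_left]
    refine (hle x _).trans ((ContinuousLinearMap.le_opNorm _ _).trans ?_)
    calc _ ≤ (D * s ^ n) * C := by
          gcongr
          exacts [hb n, hC _]
      _ = _ := by ring
  exact ⟨φ, by rwa [ha] at hlim'⟩

end IsSpectralProjection

end Projections

/-! ### Sequentially continuous functionals, complex measures and kernels -/

section SigmaContinuity

set_option synthInstance.maxHeartbeats 400000
set_option maxHeartbeats 1000000

variable {E : Type*} [MeasurableSpace E]

namespace BddMeas

theorem add_apply (f g : BddMeas E) (x : E) : (f + g) x = f x + g x := rfl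

theorem sub_apply (f g : BddMeas E) (x : E) : (f - g) x = f x - g x := rfl

theorem smul_apply (c : ℂ) (f : BddMeas E) (x : E) : (c • f) x = c * f x := rfl

theorem norm_le_of_forall {f : BddMeas E} {C : ℝ} (hC : 0 ≤ C) (h : ∀ x, ‖f x‖ ≤ C) : ‖f‖ ≤ C :=
  lp.norm_le_of_forall_le hC h

/-- Evaluation at a point. -/
noncomputable def evalL (x : E) : BddMeas E →L[ℂ] ℂ :=
  LinearMap.mkContinuous
    { toFun := fun f => f x
      map_add' := fun _ _ => rfl
      map_smul' := fun _ _ => rfl } 1 fun f => by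
        rw [one_mul]; exact f.norm_apply_le x

@[simp] theorem evalL_apply (x : E) (f : BddMeas E) : evalL x f = f x := rfl

/-- The indicator function of a measurable set. -/
noncomputable def ind (A : Set E) (hA : MeasurableSet A) : BddMeas E :=
  mk (A.indicator 1) (measurable_one.indicator hA) 1 fun x =>
    (norm_indicator_le_norm_self _ _).trans (by simp)

theorem ind_apply (A : Set E) (hA : MeasurableSet A) (x : E) : ind A hA x = A.indicator 1 x := rfl

theorem norm_ind_le (A : Set E) (hA : MeasurableSet A) : ‖ind A hA‖ ≤ 1 :=
  norm_mk_le _ _ _ _ zero_le_one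

end BddMeas

/-- A map on bounded measurable functions is `σ`-continuous (at zero) when it sends uniformly
bounded sequences converging pointwise to zero to sequences converging to zero. -/
def SigmaContinuous {X : Type*} [TopologicalSpace X] [Zero X] (ψ : BddMeas E → X) : Prop :=
  ∀ (f : ℕ → BddMeas E) (C : ℝ), (∀ k, ‖f k‖ ≤ C) →
    (∀ x, Tendsto (fun k => f k x) atTop (𝓝 0)) → Tendsto (fun k => ψ (f k)) atTop (𝓝 0)

theorem sigmaContinuous_kernelOp (Q : Kernel E E) [IsFiniteKernel Q] (x : E) :
    SigmaContinuous fun f => kernelOp Q f x := by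
  intro f C hC hf
  have h := tendsto_integral_of_dominated_convergence (μ := Q x) (F := fun k y => f k y)
    (f := fun _ => 0) (fun _ => C) (fun k => (f k).measurable.aestronglyMeasurable)
    (integrable_const C)
    (fun k => Eventually.of_forall fun y => ((f k).norm_apply_le y).trans (hC k))
    (Eventually.of_forall fun y => hf y)
  simpa [kernelOp_apply] using h

theorem SigmaContinuous.comp_op {X : Type*} [TopologicalSpace X] [Zero X] {ψ : BddMeas E → X}
    (hψ : SigmaContinuous ψ) {K : BddMeas E →L[ℂ] BddMeas E}
    (hK : ∀ x, SigmaContinuous fun f => K f x) : SigmaContinuous fun f => ψ (K f) := by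
  intro f C hC hf
  refine hψ (fun k => K (f k)) (‖K‖ * C) (fun k => ?_) fun x => hK x f C hC hf
  exact (K.le_opNorm _).trans (mul_le_mul_of_nonneg_left (hC k) (norm_nonneg K))

theorem sigmaContinuous_eval (x : E) : SigmaContinuous fun f : BddMeas E => f x :=
  fun _ _ _ hf => hf x

theorem sigmaContinuous_pow {T : BddMeas E →L[ℂ] BddMeas E}
    (hT : ∀ x, SigmaContinuous fun f => T f x) (n : ℕ) (x : E) :
    SigmaContinuous fun f => (T ^ n) f x := by
  induction n with
  | zero => exact sigmaContinuous_eval x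
  | succ n ih =>
    rw [pow_succ]
    exact ih.comp_op hT

/-- A spectral projection of a `σ`-continuous operator is `σ`-continuous for the norm. -/
theorem IsSpectralProjection.sigmaContinuous {T P : BddMeas E →L[ℂ] BddMeas E} {ρ : ℝ}
    (h : IsSpectralProjection T P ρ) (hT : ∀ x, SigmaContinuous fun f => T f x) :
    SigmaContinuous P := by
  intro f C hC hf
  exact h.tendsto_zero BddMeas.evalL (fun x f => f.norm_apply_le x)
    (fun f C hC hf => BddMeas.norm_le_of_forall hC hf) hC
    fun n x => sigmaContinuous_pow hT n x f C hC hf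

/-- The complex measure defined by a `σ`-continuous functional. -/
noncomputable def complexMeasureOf (ψ : BddMeas E →L[ℂ] ℂ) (hψ : SigmaContinuous ψ) :
    ComplexMeasure E := by
  classical
  exact
  { measureOf' := fun A => if hA : MeasurableSet A then ψ (BddMeas.ind A hA) else 0
    empty' := by
      have : BddMeas.ind (∅ : Set E) MeasurableSet.empty = 0 :=
        BddMeas.ext_apply fun x => by simp [BddMeas.ind_apply]; rfl
      simp [this]
    not_measurable' := fun A hA => by simp [hA]
    m_iUnion' := by
      intro A hA hd
      have hU : MeasurableSet (⋃ i, A i) := MeasurableSet.iUnion hA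
      simp only [hA, hU, dif_pos]
      rw [HasSum]
      -- Finite subsets of ℕ form a countable directed set, so unconditional summability can be
      -- tested along sequences, the only ones that σ-continuity handles.
      refine tendsto_of_seq_tendsto fun u hu => ?_
      have key : ∀ k x, (∑ i ∈ u k, BddMeas.ind (A i) (hA i) - BddMeas.ind _ hU : BddMeas E) x =
          -((⋃ i, A i) \ ⋃ i ∈ u k, A i).indicator (1 : E → ℂ) x := by
        intro k x
        have h1 : (∑ i ∈ u k, BddMeas.ind (A i) (hA i) : BddMeas E) x =
            (⋃ i ∈ u k, A i).indicator (1 : E → ℂ) x := by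
          rw [← BddMeas.evalL_apply, map_sum,
            Finset.indicator_biUnion (u k) A fun i _ j _ hij => hd hij]
          rfl
        rw [BddMeas.sub_apply, h1, BddMeas.ind_apply, Set.indicator_sdiff
          (Set.iUnion₂_subset fun i _ => Set.subset_iUnion A i), Pi.sub_apply, neg_sub]
      have h2 := hψ (fun k => ∑ i ∈ u k, BddMeas.ind (A i) (hA i) - BddMeas.ind _ hU) 1
        (fun k => BddMeas.norm_le_of_forall zero_le_one fun x => by
          rw [key, norm_neg]
          exact (norm_indicator_le_norm_self _ _).trans (by simp))
        (fun x => by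
          -- At each point the difference is eventually equal to 0: a point of the union is covered
          -- once `u k` contains its index.
          refine tendsto_const_nhds.congr' ?_
          by_cases hx : x ∈ ⋃ i, A i
          · obtain ⟨i, hi⟩ := Set.mem_iUnion.1 hx
            filter_upwards [hu.eventually_ge_atTop {i}] with k hk
            have hm : x ∉ (⋃ i, A i) \ ⋃ i ∈ u k, A i := fun h => h.2 (by
              simp only [Set.mem_iUnion]
              exact ⟨i, Finset.singleton_subset_iff.1 hk, hi⟩)
            rw [key, Set.indicator_of_notMem hm, neg_zero]
          · refine Eventually.of_forall fun k => ?_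
            exact ((key k x).trans (by
              rw [Set.indicator_of_notMem fun h => hx h.1, neg_zero])).symm)
      simp only [map_sub, map_sum] at h2
      have h3 := h2.add_const (ψ (BddMeas.ind _ hU))
      simp only [sub_add_cancel, zero_add] at h3
      exact h3 }

theorem complexMeasureOf_apply (ψ : BddMeas E →L[ℂ] ℂ) (hψ : SigmaContinuous ψ) {A : Set E}
    (hA : MeasurableSet A) : complexMeasureOf ψ hψ A = ψ (BddMeas.ind A hA) :=
  dif_pos hA

theorem norm_complexMeasureOf_le (ψ : BddMeas E →L[ℂ] ℂ) (hψ : SigmaContinuous ψ) (A : Set E)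
    (hA : MeasurableSet A) : ‖complexMeasureOf ψ hψ A‖ ≤ ‖ψ‖ := by
  rw [complexMeasureOf_apply ψ hψ hA]
  exact ψ.unit_le_opNorm _ (BddMeas.norm_ind_le A hA)

instance isFiniteMeasure_variation_complexMeasureOf (ψ : BddMeas E →L[ℂ] ℂ)
    (hψ : SigmaContinuous ψ) : IsFiniteMeasure (complexMeasureOf ψ hψ).variation :=
  ⟨(complex_variation_le (norm_complexMeasureOf_le ψ hψ)).trans_lt ENNReal.ofReal_lt_top⟩

theorem complexIntegral_complexMeasureOf_simpleFunc (ψ : BddMeas E →L[ℂ] ℂ)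
    (hψ : SigmaContinuous ψ) (g : SimpleFunc E ℂ) :
    ∀ h : BddMeas E, (∀ x, h x = g x) → complexIntegral (complexMeasureOf ψ hψ) g = ψ h := by
  induction g using SimpleFunc.induction with
  | const c hs =>
    classical
    rename_i s
    intro h hh
    have h1 : h = c • BddMeas.ind s hs := by
      refine BddMeas.ext_apply fun x => ?_
      rw [hh, BddMeas.smul_apply, BddMeas.ind_apply]
      by_cases hx : x ∈ s <;> simp [hx]
    have : IsFiniteMeasure ((complexMeasureOf ψ hψ).variation.restrict s) := inferInstance
    rw [complexIntegral, SimpleFunc.coe_piecewise, SimpleFunc.coe_const, SimpleFunc.coe_const,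
      Function.const_zero, Set.piecewise_eq_indicator, VectorMeasure.integral_indicator hs,
      h1, map_smul, smul_eq_mul, ← complexMeasureOf_apply ψ hψ hs]
    exact VectorMeasure.setIntegral_const c
  | add hd h1 h2 =>
    rename_i f g
    intro h hh
    obtain ⟨C, hC⟩ := f.exists_forall_norm_le
    have hg : h = BddMeas.mk f f.measurable C hC + (h - BddMeas.mk f f.measurable C hC) := by
      abel
    have e : complexIntegral (complexMeasureOf ψ hψ) (f + g) =
        complexIntegral (complexMeasureOf ψ hψ) f + complexIntegral (complexMeasureOf ψ hψ) g :=
      VectorMeasure.integral_add (SimpleFunc.integrable_of_isFiniteMeasure f)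
        (SimpleFunc.integrable_of_isFiniteMeasure g)
    rw [SimpleFunc.coe_add, e, h1 (BddMeas.mk f f.measurable C hC) fun _ => rfl,
      h2 (h - BddMeas.mk f f.measurable C hC) fun x => ?_, ← map_add, ← hg]
    rw [BddMeas.sub_apply, hh]
    simp

/-- Simple functions bounded by ‖f‖ converge to f pointwise; the integral passes to the limit by
dominated convergence, and ψ by σ-continuity. -/
theorem complexIntegral_complexMeasureOf (ψ : BddMeas E →L[ℂ] ℂ) (hψ : SigmaContinuous ψ)
    (f : BddMeas E) : complexIntegral (complexMeasureOf ψ hψ) (fun y => f y) = ψ f := by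
  have hf := f.measurable.stronglyMeasurable
  set u : ℕ → BddMeas E := fun n => BddMeas.mk (hf.approxBounded ‖f‖ n)
    (hf.approxBounded ‖f‖ n).measurable ‖f‖ (hf.norm_approxBounded_le (norm_nonneg _) n) with hu
  have h1 : Tendsto (fun n => complexIntegral (complexMeasureOf ψ hψ) (hf.approxBounded ‖f‖ n))
      atTop (𝓝 (complexIntegral (complexMeasureOf ψ hψ) fun y => f y)) := by
    refine VectorMeasure.tendsto_integral_of_dominated_convergence (fun _ => ‖f‖)
      (fun n => (SimpleFunc.stronglyMeasurable _).aestronglyMeasurable) (integrable_const _)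
      (fun n => Eventually.of_forall fun y => hf.norm_approxBounded_le (norm_nonneg _) n y)
      (Eventually.of_forall fun y => hf.tendsto_approxBounded_of_norm_le (f.norm_apply_le y))
  have h2 : ∀ n, complexIntegral (complexMeasureOf ψ hψ) (hf.approxBounded ‖f‖ n) = ψ (u n) :=
    fun n => complexIntegral_complexMeasureOf_simpleFunc ψ hψ _ (u n) fun _ => rfl
  have h3 : Tendsto (fun n => ψ (u n - f)) atTop (𝓝 0) := by
    refine hψ _ (‖f‖ + ‖f‖) (fun n => ?_) fun x => ?_
    · refine (norm_sub_le _ _).trans (add_le_add_left ?_ _)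
      exact BddMeas.norm_mk_le _ _ _ _ (norm_nonneg _)
    · have := (hf.tendsto_approxBounded_of_norm_le (f.norm_apply_le x)).sub_const (f x)
      rwa [sub_self] at this
  simp only [h2] at h1
  simp only [map_sub] at h3
  have h4 := h3.add_const (ψ f)
  simp only [sub_add_cancel, zero_add] at h4
  exact tendsto_nhds_unique h1 h4

/-- The bounded kernel of a `σ`-continuous operator. -/
noncomputable def BoundedKernel.ofOp (K : BddMeas E →L[ℂ] BddMeas E)
    (hK : ∀ x, SigmaContinuous fun f => K f x) : BoundedKernel E where
  toFun x := complexMeasureOf (BddMeas.evalL x ∘L K) (hK x)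
  measurable_apply A hA := by
    have : (fun x => complexMeasureOf (BddMeas.evalL x ∘L K) (hK x) A) =
        fun x => K (BddMeas.ind A hA) x :=
      funext fun x => complexMeasureOf_apply (BddMeas.evalL x ∘L K) (hK x) hA
    rw [this]
    exact (K (BddMeas.ind A hA)).measurable
  exists_bound := ⟨‖K‖, fun x A hA => by
    refine (congrArg norm (complexMeasureOf_apply (BddMeas.evalL x ∘L K) (hK x) hA)).trans_le ?_
    exact (BddMeas.norm_apply_le _ x).trans (K.unit_le_opNorm _ (BddMeas.norm_ind_le A hA))⟩

theorem BoundedKernel.op_ofOp (K : BddMeas E →L[ℂ] BddMeas E)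
    (hK : ∀ x, SigmaContinuous fun f => K f x) : (BoundedKernel.ofOp K hK).op = K := by
  ext1 f
  refine BddMeas.ext_apply fun x => ?_
  rw [BoundedKernel.op_apply]
  exact complexIntegral_complexMeasureOf (BddMeas.evalL x ∘L K) (hK x) f

/-- The splitting of a bounded positive kernel along a spectral projection. -/
theorem exists_boundedKernel_splitting (Q : Kernel E E) [IsFiniteKernel Q] {ρ : ℝ}
    {P : BddMeas E →L[ℂ] BddMeas E} (h : IsSpectralProjection (kernelOp Q) P ρ) :
    ∃ L N : BoundedKernel E,
      kernelOp Q = L.op + N.op ∧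
      L.op * N.op = 0 ∧ N.op * L.op = 0 ∧
      spectralRadius ℂ N.op < ENNReal.ofReal ρ ∧
      FiniteDimensional ℂ (LinearMap.range (L.op : BddMeas E →ₗ[ℂ] BddMeas E)) ∧
      ∀ z : ℂ, z ≠ 0 →
        Module.End.HasEigenvalue (L.op : BddMeas E →ₗ[ℂ] BddMeas E) z → ρ ≤ ‖z‖ := by
  set T := kernelOp Q with hT
  have hTs : ∀ x, SigmaContinuous fun f => T f x := sigmaContinuous_kernelOp Q
  have hL : ∀ x, SigmaContinuous fun f => (T * P) f x := fun x =>
    (hTs x).comp_op fun y f C hC hf => by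
      have h1 := ((BddMeas.evalL y).continuous.tendsto 0).comp (h.sigmaContinuous hTs f C hC hf)
      rwa [map_zero] at h1
  -- T (1 - P) is the difference of the σ-continuous operators T and T P.
  have hN : ∀ x, SigmaContinuous fun f => (T * (1 - P)) f x := fun x f C hC hf => by
    have h1 := (hTs x f C hC hf).sub (hL x f C hC hf)
    rw [sub_zero] at h1
    refine h1.congr fun k => ?_
    rw [mul_sub, mul_one]
    rfl
  refine ⟨BoundedKernel.ofOp _ hL, BoundedKernel.ofOp _ hN, ?_⟩
  rw [BoundedKernel.op_ofOp, BoundedKernel.op_ofOp]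
  exact ⟨IsSpectralProjection.mul_eq_add T P, h.mul_mul_mul_one_sub, h.mul_one_sub_mul_mul,
    h.spectralRadius_mul_one_sub_lt, h.finiteDimensional_range_mul,
    fun z hz he => h.le_norm_of_hasEigenvalue hz he⟩

end SigmaContinuity

/-! ### Dominating probability measure and the Doeblin-type estimates -/

section Doeblin

set_option synthInstance.maxHeartbeats 400000
set_option maxHeartbeats 1000000

variable {E : Type*} [MeasurableSpace E]

instance isFiniteKernel_pow (Q : Kernel E E) [IsFiniteKernel Q] (n : ℕ) :
    IsFiniteKernel (Q ^ n) := by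
  induction n with
  | zero => exact inferInstanceAs (IsFiniteKernel (Kernel.id : Kernel E E))
  | succ n ih => exact inferInstanceAs (IsFiniteKernel ((Q ^ n) ∘ₖ Q))

theorem integral_kernel_pow (Q : Kernel E E) [IsFiniteKernel Q] (n : ℕ) (f : BddMeas E) (x : E) :
    ∫ y, f y ∂((Q ^ n) x) = (kernelOp Q ^ n) f x := by
  induction n generalizing x with
  | zero =>
    change ∫ y, f y ∂((Kernel.id : Kernel E E) x) = f x
    rw [Kernel.id_apply, integral_dirac' _ _ f.measurable.stronglyMeasurable]
  | succ n ih =>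
    have h1 : ∫ y, f y ∂(((Q ^ n) ∘ₖ Q) x) = ∫ y, ∫ z, f z ∂((Q ^ n) y) ∂(Q x) :=
      Kernel.integral_comp (integrable_kernel ((Q ^ n) ∘ₖ Q) f x)
    refine h1.trans ?_
    -- Q^(n+1) integrates Q^n(y, ·) against Q(x, dy), so the outer operator is T, applied to T^n f.
    rw [pow_succ']
    change _ = kernelOp Q ((kernelOp Q ^ n) f) x
    rw [kernelOp_apply]
    exact integral_congr_ae (Eventually.of_forall ih)

theorem kernel_pow_apply (Q : Kernel E E) [IsFiniteKernel Q] (n : ℕ) (x : E) {A : Set E}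
    (hA : MeasurableSet A) :
    (Q ^ n) x A = ENNReal.ofReal ‖(kernelOp Q ^ n) (BddMeas.ind A hA) x‖ := by
  rw [← integral_kernel_pow]
  have h1 : ∫ y, BddMeas.ind A hA y ∂((Q ^ n) x) = (((Q ^ n) x).real A : ℂ) := by
    simp_rw [BddMeas.ind_apply]
    rw [integral_indicator hA]
    simp [measureReal_def]
  rw [h1, Complex.norm_real, Real.norm_of_nonneg measureReal_nonneg, ofReal_measureReal]

/-- Coordinates in a basis of the range. Their control by ‖P v‖ is what transfers σ-continuity from
P to each coordinate functional. -/
theorem exists_finite_rank_expansion {B : Type*} [NormedAddCommGroup B] [NormedSpace ℂ B]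
    (P : B →L[ℂ] B) (hfin : FiniteDimensional ℂ (LinearMap.range (P : B →ₗ[ℂ] B))) :
    ∃ (d : ℕ) (e : Fin d → B) (ψ : Fin d → B →L[ℂ] ℂ),
      (∀ v, ‖P v‖ ≤ ∑ i, ‖ψ i v‖ * ‖e i‖) ∧ ∀ i, ∃ C : ℝ, ∀ v, ‖ψ i v‖ ≤ C * ‖P v‖ := by
  let b := Module.finBasis ℂ (LinearMap.range (P : B →ₗ[ℂ] B))
  let p : B →L[ℂ] LinearMap.range (P : B →ₗ[ℂ] B) := P.codRestrict _ fun x => ⟨x, rfl⟩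
  let χ := fun i => LinearMap.toContinuousLinearMap (b.coord i)
  refine ⟨_, fun i => (b i : B), fun i => χ i ∘L p, fun v => ?_, fun i => ⟨‖χ i‖, fun v => ?_⟩⟩
  · have h1 : P v = ∑ i, χ i (p v) • (b i : B) := by
      have h2 := congrArg Subtype.val (b.sum_repr (p v))
      rw [Submodule.coe_sum] at h2
      exact h2.symm
    rw [h1]
    refine (norm_sum_le _ _).trans (le_of_eq ?_)
    simp only [norm_smul]
    rfl
  · exact (χ i).le_opNorm (p v)

/-- A `σ`-continuous operator of finite rank is dominated by a probability measure. -/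
theorem exists_probabilityMeasure_dominating [Nonempty E] {P : BddMeas E →L[ℂ] BddMeas E}
    (hP : SigmaContinuous P)
    (hfin : FiniteDimensional ℂ (LinearMap.range (P : BddMeas E →ₗ[ℂ] BddMeas E))) :
    ∃ ν : Measure E, IsProbabilityMeasure ν ∧ ∃ M : ℝ, 0 ≤ M ∧
      ∀ (A : Set E) (hA : MeasurableSet A), ‖P (BddMeas.ind A hA)‖ ≤ M * ν.real A := by
  obtain ⟨d, e, ψ, hPe, hψ⟩ := exists_finite_rank_expansion P hfin
  have hs : ∀ i, SigmaContinuous (ψ i) := by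
    intro i f C hC hf
    obtain ⟨D, hD⟩ := hψ i
    refine squeeze_zero_norm (fun k => hD (f k)) ?_
    have h1 := (hP f C hC hf).norm.const_mul D
    rwa [norm_zero, mul_zero] at h1
  let m : Fin d → Measure E := fun i => (complexMeasureOf (ψ i) (hs i)).variation
  have hm : ∀ i, IsFiniteMeasure (m i) := fun i =>
    isFiniteMeasure_variation_complexMeasureOf (ψ i) (hs i)
  -- The Dirac mass keeps the total mass positive, even if all variations vanish, so that μ can be
  -- normalised.
  let μ : Measure E := ∑ i, m i + Measure.dirac (Classical.arbitrary E)
  have hμ0 : NeZero μ := ⟨fun h0 => by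
    have h1 : μ Set.univ = 0 := by rw [h0]; rfl
    rw [Measure.add_apply] at h1
    have h2 := (add_eq_zero.1 h1).2
    rw [measure_univ] at h2
    exact one_ne_zero h2⟩
  have hfinμ : IsFiniteMeasure μ := inferInstance
  refine ⟨(μ Set.univ)⁻¹ • μ, isProbabilityMeasureSMul, (∑ i, ‖e i‖) * μ.real Set.univ,
    by positivity, fun A hA => ?_⟩
  have h2 : μ.real Set.univ * ((μ Set.univ)⁻¹ • μ).real A = μ.real A := by
    rw [measureReal_ennreal_smul_apply, ENNReal.toReal_inv, ← measureReal_def, ← mul_assoc,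
      mul_inv_cancel₀ (measureReal_univ_ne_zero (μ := μ)), one_mul]
  rw [mul_assoc, h2, Finset.sum_mul]
  refine (hPe _).trans (Finset.sum_le_sum fun i _ => ?_)
  rw [mul_comm]
  refine mul_le_mul_of_nonneg_left ?_ (norm_nonneg _)
  rw [← complexMeasureOf_apply (ψ i) (hs i) hA]
  refine (VectorMeasure.norm_measure_le_variation (measure_ne_top (m i) A)).trans ?_
  refine ENNReal.toReal_mono (measure_ne_top μ A) ?_
  have h3 : m i ≤ μ :=
    (Finset.single_le_sum (f := m) (fun _ _ => Measure.zero_le _) (Finset.mem_univ i)).trans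
      (Measure.le_add_right le_rfl)
  exact h3 A

theorem kernel_pow_apply_le (Q : Kernel E E) [IsFiniteKernel Q]
    {P : BddMeas E →L[ℂ] BddMeas E} {ν : Measure E} {M : ℝ}
    (hν : ∀ (A : Set E) (hA : MeasurableSet A), ‖P (BddMeas.ind A hA)‖ ≤ M * ν.real A)
    (n : ℕ) (x : E) {A : Set E} (hA : MeasurableSet A) :
    (Q ^ n) x A ≤ ENNReal.ofReal
      (‖kernelOp Q ^ n‖ * (M * ν.real A) + ‖kernelOp Q ^ n * (1 - P)‖) := by
  rw [kernel_pow_apply Q n x hA]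
  refine ENNReal.ofReal_le_ofReal ?_
  rw [IsSpectralProjection.pow_apply_eq (P := P) n, BddMeas.add_apply]
  refine (norm_add_le _ _).trans (add_le_add ?_ ?_)
  · refine (BddMeas.norm_apply_le _ x).trans ((ContinuousLinearMap.le_opNorm _ _).trans ?_)
    exact mul_le_mul_of_nonneg_left (hν A hA) (ContinuousLinearMap.opNorm_nonneg _)
  · exact (BddMeas.norm_apply_le _ x).trans
      (ContinuousLinearMap.unit_le_opNorm _ _ (BddMeas.norm_ind_le A hA))

theorem doeblinDelta_le {ν : Measure E} {κ : Kernel E E} {δ c : ℝ≥0∞} (hδ : 0 < δ)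
    (h : ∀ A, MeasurableSet A → ν A < δ → ∀ x, κ x A ≤ c) : doeblinDelta ν κ ≤ c := by
  refine limsup_le_of_le (by isBoundedDefault) ?_
  filter_upwards [preimage_mem_comap (Iio_mem_nhds hδ)] with A hA
  exact iSup_le (h A A.2 hA)

/-- If `κ x A ≤ c` whenever `ν A` is small, then `κ` dominates an absolutely continuous kernel
with bounded density, up to a remainder of mass at most `c`. -/
theorem exists_acKernel_add [MeasurableSpace.CountablyGenerated E] (ν : Measure E)
    [IsFiniteMeasure ν] (κ : Kernel E E) [IsFiniteKernel κ] {δ c : ℝ≥0∞} (hδ : 0 < δ)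
    (h : ∀ A, MeasurableSet A → ν A < δ → ∀ x, κ x A ≤ c) :
    ∃ α ∈ UnifIntegrableSections ν, ∃ S : Kernel E E, ∃ _ : IsFiniteKernel S,
      κ = acKernel ν α + S ∧ ∀ x, S x Set.univ ≤ c := by
  set η : Kernel E E := Kernel.const E ν with hη
  set β : E → E → ℝ≥0∞ := κ.rnDeriv η with hβ
  have hβm : Measurable fun p : E × E => β p.1 p.2 := Kernel.measurable_rnDeriv κ η
  -- By Markov's inequality this level forces the set where the density exceeds m to have ν-measure
  -- below δ, for every x.
  obtain ⟨m, hm⟩ : ∃ m : ℝ≥0, κ.bound < δ * m := by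
    by_cases hδt : δ = ∞
    · exact ⟨1, by simpa [hδt] using κ.bound_lt_top⟩
    · obtain ⟨m, hm⟩ := ENNReal.exists_nat_gt (ENNReal.div_lt_top κ.bound_ne_top hδ.ne').ne
      refine ⟨m, ?_⟩
      rw [ENNReal.div_lt_iff (Or.inl hδ.ne') (Or.inl hδt)] at hm
      rw [mul_comm]
      exact_mod_cast hm
  have hset : MeasurableSet {p : E × E | β p.1 p.2 ≤ m} := measurableSet_le hβm measurable_const
  -- The density is set to 0 above m, not capped at m; the leftover density γ is thus supported
  -- where β > m.
  set α : E × E → ℝ≥0 := fun p => if β p.1 p.2 ≤ m then (β p.1 p.2).toNNReal else 0 with hα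
  have hαm : Measurable α := Measurable.ite hset hβm.ennreal_toNNReal measurable_const
  set γ : E → E → ℝ≥0∞ := fun x y => if β x y ≤ m then 0 else β x y with hγ
  have hγm : Measurable (Function.uncurry γ) := Measurable.ite hset measurable_const hβm
  have hsum : ∀ x y, (α (x, y) : ℝ≥0∞) + γ x y = β x y := by
    intro x y
    by_cases hxy : β x y ≤ m
    · simp [hα, hγ, hxy, ENNReal.coe_toNNReal (ne_top_of_le_ne_top ENNReal.coe_ne_top hxy)]
    · simp [hα, hγ, hxy]
  have hαle : ∀ p, α p ≤ m := by
    intro p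
    by_cases hp : β p.1 p.2 ≤ m
    · simp only [hα, hp, if_true]
      exact ENNReal.coe_le_coe.1 (ENNReal.coe_toNNReal_le_self.trans hp)
    · simp [hα, hp]
  set S : Kernel E E := η.withDensity γ + κ.singularPart η with hS
  have hκ : κ = acKernel ν α + S := by
    have h1 : η.withDensity β = acKernel ν α + η.withDensity γ := by
      ext x A hA
      rw [add_apply, Measure.add_apply, acKernel_apply ν hαm x hA,
        Kernel.withDensity_apply' η hγm, Kernel.withDensity_apply' η hβm, Kernel.const_apply,
        ← lintegral_add_left (f := fun y => (α (x, y) : ℝ≥0∞))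
          (hαm.comp measurable_prodMk_left).coe_nnreal_ennreal]
      simp_rw [hsum]
      rfl
    conv_lhs => rw [← Kernel.rnDeriv_add_singularPart κ η]
    rw [← hβ, h1, add_assoc]
  have hSκ : ∀ x A, S x A ≤ κ x A := by
    intro x A
    conv_rhs => rw [hκ]
    exact le_add_self
  refine ⟨α, ⟨hαm, ?_⟩, S, ⟨κ.bound, κ.bound_lt_top, fun x =>
    (hSκ x _).trans (κ.measure_le_bound x _)⟩, hκ, fun x => ?_⟩
  · refine tendsto_const_nhds.congr' ?_
    filter_upwards [eventually_gt_atTop (m : ℝ)] with t ht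
    have hempty : ∀ x, {y | t ≤ (α (x, y) : ℝ)} = ∅ := fun x =>
      Set.eq_empty_of_forall_notMem fun y hy =>
        absurd (hy.trans (NNReal.coe_le_coe.2 (hαle (x, y)))) (not_le.2 ht)
    simp [hempty]
  · have hslice := Kernel.measurableSet_mutuallySingularSetSlice κ η x
    have hxset : MeasurableSet {y | β x y ≤ m} := measurable_prodMk_left hset
    -- D carries all of S(x, ·), and ν(D) < δ because the singular slice is ν-null. Hence S(x, E) ≤
    -- κ(x, D) ≤ c.
    set D : Set E := {y | β x y ≤ m}ᶜ ∪ κ.mutuallySingularSetSlice η x with hD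
    have hDm : MeasurableSet D := hxset.compl.union hslice
    have hνD : ν D < δ := by
      have h2 : ν (κ.mutuallySingularSetSlice η x) = 0 := by
        have := Kernel.measure_mutuallySingularSetSlice κ η x
        rwa [hη, Kernel.const_apply] at this
      have h3 : m * ν {y | β x y ≤ m}ᶜ < δ * m := by
        refine lt_of_le_of_lt ?_ hm
        calc m * ν {y | β x y ≤ m}ᶜ ≤ m * ν {y | (m : ℝ≥0∞) ≤ β x y} := by
              gcongr
              intro y hy
              have hy' : ¬ β x y ≤ m := hy
              exact (lt_of_not_ge hy').le
          _ ≤ ∫⁻ y, β x y ∂ν :=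
              mul_meas_ge_le_lintegral (hβm.comp measurable_prodMk_left) _
          _ ≤ κ x Set.univ := by
              have := Kernel.setLIntegral_rnDeriv_le (κ := κ) (η := η) (a := x)
                MeasurableSet.univ
              rwa [Measure.restrict_univ, hη, Kernel.const_apply] at this
          _ ≤ κ.bound := κ.measure_le_bound x _
      refine (measure_union_le _ _).trans_lt ?_
      rw [h2, add_zero]
      rw [mul_comm δ] at h3
      exact lt_of_mul_lt_mul_left' h3
    have hSD : S x Dᶜ = 0 := by
      rw [hS, add_apply, Measure.add_apply, add_eq_zero]
      constructor
      · rw [Kernel.withDensity_apply' η hγm, setLIntegral_eq_zero_iff (f := γ x) hDm.compl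
          (hγm.comp measurable_prodMk_left)]
        refine Eventually.of_forall fun y hy => ?_
        have hy' : β x y ≤ m := by
          by_contra hn
          exact hy (Or.inl hn)
        simp [hγ, hy']
      · refine measure_mono_null (fun y hy => ?_)
          (Kernel.singularPart_compl_mutuallySingularSetSlice κ η x)
        exact fun hn => hy (Or.inr hn)
    calc S x Set.univ ≤ S x D + S x Dᶜ := by
          rw [← Set.union_compl_self D]; exact measure_union_le _ _
      _ = S x D := by rw [hSD, add_zero]
      _ ≤ κ x D := hSκ x D
      _ ≤ c := h D hDm hνD x

theorem norm_kernelOp_le (S : Kernel E E) [IsFiniteKernel S] {r : ℝ} (hr : 0 ≤ r)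
    (h : ∀ x, S x Set.univ ≤ ENNReal.ofReal r) : ‖kernelOp S‖ ≤ r := by
  refine ContinuousLinearMap.opNorm_le_bound _ hr fun f => ?_
  refine BddMeas.norm_le_of_forall (by positivity) fun x => ?_
  rw [kernelOp_apply]
  refine (norm_integral_le_of_norm_le_const (μ := S x) (C := ‖f‖)
    (Eventually.of_forall fun y => f.norm_apply_le y)).trans ?_
  rw [mul_comm]
  gcongr
  exact ENNReal.toReal_le_of_le_ofReal hr (h x)

/-- The measure comes from P alone, so one ν serves every ℓ; the size of ℓ only serves to get C s^ℓ
< ρ^ℓ. -/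
theorem exists_doeblin_measure (Q : Kernel E E) [IsFiniteKernel Q] [Nonempty E] {ρ : ℝ}
    {P : BddMeas E →L[ℂ] BddMeas E} (h : IsSpectralProjection (kernelOp Q) P ρ) :
    ∃ ℓ₀ : ℕ, 1 ≤ ℓ₀ ∧ ∀ ℓ : ℕ, ℓ₀ ≤ ℓ →
      ∃ ν : Measure E, ∃ _ : IsProbabilityMeasure ν,
        doeblinDelta ν (Q ^ ℓ) ≤ ENNReal.ofReal (ρ ^ ℓ) ∧
        (MeasurableSpace.CountablyGenerated E →
          ∃ α ∈ UnifIntegrableSections ν, ∃ S : Kernel E E, ∃ _ : IsFiniteKernel S,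
            Q ^ ℓ = acKernel ν α + S ∧
            ‖kernelOp S‖ ^ (1 / (ℓ : ℝ)) < ρ) := by
  obtain ⟨ν, hν, M, hM, hb⟩ := exists_probabilityMeasure_dominating
    (h.sigmaContinuous (sigmaContinuous_kernelOp Q)) h.finiteDimensional
  obtain ⟨s, hs, hsρ, C, hC, hgrow⟩ := h.growth
  have hρ : 0 < ρ := hs.trans hsρ
  have hlim : Tendsto (fun n : ℕ => C * (s / ρ) ^ n) atTop (𝓝 0) := by
    have h1 := (tendsto_pow_atTop_nhds_zero_of_lt_one (by positivity)
      ((div_lt_one hρ).2 hsρ)).const_mul C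
    rwa [mul_zero] at h1
  obtain ⟨ℓ₁, hℓ₁⟩ := eventually_atTop.1 (hlim.eventually_lt_const zero_lt_one)
  refine ⟨max 1 ℓ₁, le_max_left _ _, fun ℓ hℓ => ⟨ν, hν, ?_⟩⟩
  have hℓ0 : ℓ ≠ 0 := by
    have := (le_max_left 1 ℓ₁).trans hℓ
    omega
  have hlt : ‖kernelOp Q ^ ℓ * (1 - P)‖ < ρ ^ ℓ := by
    refine (hgrow ℓ).trans_lt ?_
    have h1 := hℓ₁ ℓ ((le_max_right 1 ℓ₁).trans hℓ)
    rwa [div_pow, ← mul_div_assoc, div_lt_one (by positivity)] at h1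
  -- The gap below r leaves room for the ν(A) term; the gap above r gives the strict inequality for
  -- ‖S‖.
  obtain ⟨r, hr₁, hr₂⟩ := exists_between hlt
  have hr0 : 0 ≤ r := (ContinuousLinearMap.opNorm_nonneg _).trans hr₁.le
  set K : ℝ := ‖kernelOp Q ^ ℓ‖ * M + 1 with hK
  have hK0 : 0 < K := by positivity
  have hδ : 0 < ENNReal.ofReal ((r - ‖kernelOp Q ^ ℓ * (1 - P)‖) / K) :=
    ENNReal.ofReal_pos.2 (div_pos (sub_pos.2 hr₁) hK0)
  have hsmall : ∀ A, MeasurableSet A →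
      ν A < ENNReal.ofReal ((r - ‖kernelOp Q ^ ℓ * (1 - P)‖) / K) →
      ∀ x, (Q ^ ℓ) x A ≤ ENNReal.ofReal r := by
    intro A hA hνA x
    refine (kernel_pow_apply_le Q hb ℓ x hA).trans (ENNReal.ofReal_le_ofReal ?_)
    have h1 : ν.real A < (r - ‖kernelOp Q ^ ℓ * (1 - P)‖) / K := by
      rwa [measureReal_def, ← ENNReal.lt_ofReal_iff_toReal_lt (measure_ne_top ν A)]
    rw [lt_div_iff₀ hK0, hK] at h1
    have h2 : 0 ≤ ν.real A := measureReal_nonneg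
    linarith
  refine ⟨(doeblinDelta_le hδ hsmall).trans (ENNReal.ofReal_le_ofReal hr₂.le), fun hE => ?_⟩
  obtain ⟨α, hα, S, hSfin, hQS, hS⟩ := exists_acKernel_add ν (Q ^ ℓ) hδ hsmall
  refine ⟨α, hα, S, hSfin, hQS, ?_⟩
  have hpos : 0 < 1 / (ℓ : ℝ) := by positivity
  calc ‖kernelOp S‖ ^ (1 / (ℓ : ℝ)) ≤ r ^ (1 / (ℓ : ℝ)) :=
        Real.rpow_le_rpow (ContinuousLinearMap.opNorm_nonneg _) (norm_kernelOp_le S hr0 hS) hpos.le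
    _ < (ρ ^ ℓ) ^ (1 / (ℓ : ℝ)) := Real.rpow_lt_rpow hr0 hr₂ hpos
    _ = ρ := by rw [one_div, Real.pow_rpow_inv_natCast hρ.le hℓ0]

end Doeblin

end QuasiCompactKernels

/-! ### Conclusion -/

open QuasiCompactKernels in
theorem mainTheorem2 {E : Type*} [MeasurableSpace E] (Q : Kernel E E) [IsFiniteKernel Q]
    (hQ : IsQuasiCompact (kernelOp Q)) (ρ : ℝ)
    (hρ₁ : essSpectralRadius (kernelOp Q) < ENNReal.ofReal ρ)
    (hρ₂ : ENNReal.ofReal ρ < spectralRadius ℂ (kernelOp Q)) :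
    (∃ L N : BoundedKernel E,
      kernelOp Q = L.op + N.op ∧
      L.op * N.op = 0 ∧ N.op * L.op = 0 ∧
      spectralRadius ℂ N.op < ENNReal.ofReal ρ ∧
      FiniteDimensional ℂ (LinearMap.range (L.op : BddMeas E →ₗ[ℂ] BddMeas E)) ∧
      ∀ z : ℂ, z ≠ 0 →
        Module.End.HasEigenvalue (L.op : BddMeas E →ₗ[ℂ] BddMeas E) z → ρ ≤ ‖z‖) ∧
    ∃ ℓ₀ : ℕ, 1 ≤ ℓ₀ ∧ ∀ ℓ : ℕ, ℓ₀ ≤ ℓ →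
      ∃ ν : Measure E, ∃ _ : IsProbabilityMeasure ν,
        doeblinDelta ν (Q ^ ℓ) ≤ ENNReal.ofReal (ρ ^ ℓ) ∧
        (MeasurableSpace.CountablyGenerated E →
          ∃ α ∈ UnifIntegrableSections ν, ∃ S : Kernel E E, ∃ _ : IsFiniteKernel S,
            Q ^ ℓ = acKernel ν α + S ∧
            ‖kernelOp S‖ ^ (1 / (ℓ : ℝ)) < ρ) := by
  obtain ⟨P, hP⟩ := exists_isSpectralProjection_of_essSpectralRadius_lt hρ₁ hρ₂
  -- Over an empty E the operator algebra is trivial and its spectral radius is 0, contrary to ρ <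
  -- r(Q).
  have hE : Nonempty E := by
    by_contra hE
    rw [not_nonempty_iff] at hE
    have hsub : Subsingleton (BddMeas E) := ⟨fun f g => BddMeas.ext_apply fun x => hE.elim x⟩
    have : Subsingleton (BddMeas E →L[ℂ] BddMeas E) :=
      ⟨fun S T => ContinuousLinearMap.ext fun f => Subsingleton.elim _ _⟩
    rw [spectrum.SpectralRadius.of_subsingleton] at hρ₂
    exact not_lt_zero hρ₂
  exact ⟨exists_boundedKernel_splitting Q hP, exists_doeblin_measure Q hP⟩
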